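/- Let $\mathsf B_n$ ($n\ge 0$) be the Bernoulli numbers, defined by $\frac{t}{e^t-1}=\sum_{n\ge 0}\mathsf B_n\frac{t^n}{n!}$. For each positive integer $k$, let $\mathfrak B_k\in\mathbb Q^{k\times k}$ be the Betti matrix, with entries $$(\mathfrak B_k)_{a,b}=\frac{(-1)^{a+1}}{2^{2k+2}}\,\frac{(2k+1-a)!\,(2k+1-b)!}{(2k+2-a-b)!}\,\frac{\mathsf B_{2k+2-a-b}}{(-1)^{\lfloor (2k+1-a-b)/2\rfloor}}\qquad(1\le a,b\le k),$$ and let $\mathfrak B_k^{\mathrm e}\in\mathbb Q^{\lfloor k/2\rfloor\times\lfloor k/2\rfloor}$ be its minor formed by the even-numbered rows and columns, $(\mathfrak B_k^{\mathrm e})_{a,b}=(\mathfrak B_k)_{2a,2b}$, where $\mathfrak B_1^{\mathrm e}$ is the empty matrix and $\det\mathfrak B_1^{\mathrm e}=1$. Write $n!!$ for the double factorial, with $0!!=1$. Then, for each positive integer $k$, $$\det\mathfrak B_k^{\mathrm e}=\frac{[(2k+1)!!]^{\frac{3-(-1)^k}{2}}}{(-2)^{\lfloor k/2\rfloor}\,(k-1)!!\,(k!!)^{1-(-1)^k}}\left[\frac{(2k+1)!!}{2^{k+1}}\right]^{2\lfloor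 k/2\rfloor}\prod_{j=1}^k\frac{(2j)^{k-j}}{(2j+1)^{j+1}}.$$ Moreover, for each positive integer $m$, $$\det\left(\frac{\mathsf B_{2(a+b)}}{[2(a+b)]!}\right)_{1\le a,b\le m}=(-1)^m\prod_{n=1}^m\frac{[(2n)!]^2}{(4n)!\,(4n+1)!}.$$ -/

import Mathlib

open scoped Nat

/-- The `(a, b)` entry of the Betti matrix of size `k`, with `1 ≤ a, b ≤ k` counted from one.
In that range no natural-number subtraction truncates. Here `bernoulli` is the Bernoulli sequence
with generating function `t / (exp t - 1)`. -/
def bettiEntry (k a b : ℕ) : ℚ :=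
  (-1) ^ (a + 1) / 2 ^ (2 * k + 2) *
    (((2 * k + 1 - a)! : ℚ) * ((2 * k + 1 - b)! : ℚ) / ((2 * k + 2 - a - b)! : ℚ)) *
    (bernoulli (2 * k + 2 - a - b) / (-1) ^ ((2 * k + 1 - a - b) / 2))

/-- The Betti matrix of size `k`; the index `i : Fin k` stands for row (or column) `i + 1`. -/
def bettiMatrix (k : ℕ) : Matrix (Fin k) (Fin k) ℚ :=
  Matrix.of fun i j => bettiEntry k (i + 1) (j + 1)

/-- The zero-based position in `Fin k` of the row (or column) with one-based number
`2 * (i + 1)`. -/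
def evenIndex (k : ℕ) (i : Fin (k / 2)) : Fin k :=
  ⟨2 * i + 1, by omega⟩

/-- The minor of the Betti matrix formed by the rows and columns whose one-based numbers are
even. For `k = 1` it is the empty matrix. -/
def bettiEvenMinor (k : ℕ) : Matrix (Fin (k / 2)) (Fin (k / 2)) ℚ :=
  (bettiMatrix k).submatrix (evenIndex k) (evenIndex k)

/-- The `m × m` matrix with entries `B_{2(a+b)} / (2(a+b))!`, where `1 ≤ a, b ≤ m` and
`a = i + 1`, `b = j + 1`. -/
def bernoulliHankel (m : ℕ) : Matrix (Fin m) (Fin m) ℚ :=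
  Matrix.of fun i j =>
    bernoulli (2 * ((i + 1) + (j + 1))) / ((2 * ((i + 1) + (j + 1)))! : ℚ)

/-!
Put `c m = B_{2m} / (2m)!`, so that `x * coth x = ∑ c m * w ^ m` with `w = 4 * x ^ 2`. Both
determinants reduce to Hankel determinants of the sequence `c`, started at `c 2` for
`bernoulliHankel`, and at `c 1` or `c 2` (for `k` even or odd) for the Betti minor, whose rows and
columns have to be reversed and rescaled (`det_bettiEvenMinor`).

The Hankel determinants come from the continued fraction of `x * coth x`. The modified spherical
Bessel functions satisfy a three-term recurrence (`besselSeries_eq`) that starts with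
`sinh x / x` and `cosh x`. Running it forwards gives polynomials `P n`, `Q n` (`besselRec`) such that
`P n * (x * coth x) + Q n` is divisible by `w ^ n` (`besselRec_mul_cothSeries_add`), although the
degrees of `P n` and `Q n` are only about `n / 2`. Hence many consecutive coefficients of
`P n * ∑ c m * w ^ m` vanish, while the one at `w ^ n` is known. Read backwards, the coefficients of
`P n` therefore combine the rows of a Hankel matrix of `c` into a multiple of the last unit vector
(`sum_besselRec_mul_bernoulli`), so that the quotient of consecutive Hankel determinants is explicit
(`det_bernoulliHankelShift_succ`).

The closed forms follow by induction on the size of the matrix; for the Betti minor the step goes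
from `k` to `k + 2`, since the index at which the Hankel matrix starts depends on the parity of `k`.
-/

/-! ### Hankel determinants -/

/-- The Hankel matrix `(h (i + j))` with `i, j < N`. -/
def hankelMatrix (h : ℕ → ℚ) (N : ℕ) : Matrix (Fin N) (Fin N) ℚ :=
  Matrix.of fun i j => h (i + j)

/-- If a combination of the rows of a Hankel matrix is a multiple of the last unit vector, then
expanding along the last row relates its determinant to the one of the next smaller size. -/
theorem det_hankelMatrix_succ (h p : ℕ → ℚ) (N : ℕ) (r : ℚ)
    (h0 : ∀ j < N, ∑ i ∈ Finset.range (N + 1), p i * h (i + j) = 0)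
    (hr : ∑ i ∈ Finset.range (N + 1), p i * h (i + N) = r) :
    p N * (hankelMatrix h (N + 1)).det = r * (hankelMatrix h N).det := by
  have key := Matrix.det_updateRow_sum (hankelMatrix h (N + 1)) (Fin.last N) (fun i => p i)
  have hrow : (∑ k : Fin (N + 1), p k • hankelMatrix h (N + 1) k) =
      Pi.single (Fin.last N) r := by
    funext j
    have hs : (∑ k : Fin (N + 1), p k • hankelMatrix h (N + 1) k) j =
        ∑ i ∈ Finset.range (N + 1), p i * h (i + j) := by
      rw [← Fin.sum_univ_eq_sum_range (fun i => p i * h (i + j))]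
      simp [hankelMatrix, Finset.sum_apply]
    rw [hs]
    refine Fin.lastCases ?_ (fun j => ?_) j
    · simpa using hr
    · rw [Pi.single_eq_of_ne (Fin.castSucc_lt_last j).ne]
      simpa using h0 j j.2
  rw [hrow] at key
  simp only [Fin.val_last, smul_eq_mul] at key
  rw [← key, Matrix.det_succ_row _ (Fin.last N), Finset.sum_eq_single (Fin.last N)]
  · have hsign : ((-1 : ℚ)) ^ (N + N) = 1 := Even.neg_one_pow ⟨N, rfl⟩
    simp only [Fin.val_last, hsign, Matrix.updateRow_self, Pi.single_eq_same, one_mul,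
      Fin.succAbove_last]
    congr 2
    ext i j
    simp [hankelMatrix, Matrix.updateRow_apply, (Fin.castSucc_lt_last i).ne]
  · intro j _ hj
    simp [Matrix.updateRow_self, Pi.single_eq_of_ne hj]
  · simp

/-! ### Power series of hyperbolic and Bessel functions -/

/-- The sum `∑ B_{2n} / (2n)! * w ^ n`, that is, `x * coth x` with `w = 4 * x ^ 2`. -/
noncomputable def cothSeries : PowerSeries ℚ :=
  PowerSeries.mk fun n => bernoulli (2 * n) / ((2 * n)! : ℚ)

/-- `cosh x` as a power series in `w = 4 * x ^ 2`. -/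
noncomputable def coshSeries : PowerSeries ℚ :=
  PowerSeries.mk fun n => 1 / (4 ^ n * ((2 * n)! : ℚ))

/-- The modified spherical Bessel function of order `n` divided by `x ^ n`, as a power series in
`w = 4 * x ^ 2`; for `n = 0` it is `sinh x / x`. -/
noncomputable def besselSeries (n : ℕ) : PowerSeries ℚ :=
  PowerSeries.mk fun m => 1 / (4 ^ m * ((2 * m)‼ : ℚ) * ((2 * n + 2 * m + 1)‼ : ℚ))

theorem sum_range_two_mul_add_two (f : ℕ → ℚ) (n : ℕ) :
    ∑ i ∈ Finset.range (2 * n + 2), f i =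
      ∑ i ∈ Finset.range (n + 1), (f (2 * i) + f (2 * i + 1)) := by
  induction n with
  | zero => simp [Finset.sum_range_succ]
  | succ n ih =>
    rw [show 2 * (n + 1) + 2 = 2 * n + 2 + 1 + 1 by ring, Finset.sum_range_succ,
      Finset.sum_range_succ, ih, Finset.sum_range_succ _ (n + 1)]
    rw [show 2 * (n + 1) = 2 * n + 2 by ring]
    ring

/-- The generating function of the Bernoulli numbers in symmetric form. -/
theorem bernoulliPowerSeries_add_mul_exp_sub :
    (bernoulliPowerSeries ℚ + PowerSeries.C (1 / 2) * PowerSeries.X) *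
        (PowerSeries.rescale (1 / 2 : ℚ) (PowerSeries.exp ℚ) -
          PowerSeries.rescale (-1 / 2 : ℚ) (PowerSeries.exp ℚ)) =
      PowerSeries.C (1 / 2) * PowerSeries.X *
        (PowerSeries.rescale (1 / 2 : ℚ) (PowerSeries.exp ℚ) +
          PowerSeries.rescale (-1 / 2 : ℚ) (PowerSeries.exp ℚ)) := by
  have h1 := PowerSeries.exp_mul_exp_eq_exp_add (A := ℚ) 1 (-1 / 2)
  rw [show (1 : ℚ) + -1 / 2 = 1 / 2 by norm_num, PowerSeries.rescale_one, RingHom.id_apply] at h1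
  have h2 := bernoulliPowerSeries_mul_exp_sub_one ℚ
  have h3 : (PowerSeries.C (1 / 2 : ℚ)) * 2 = 1 := by
    rw [← map_ofNat (PowerSeries.C (R := ℚ)) 2, ← map_mul]; norm_num
  rw [← h1]
  linear_combination (PowerSeries.rescale (-1 / 2 : ℚ) (PowerSeries.exp ℚ)) * h2 -
    PowerSeries.X * (PowerSeries.rescale (-1 / 2 : ℚ) (PowerSeries.exp ℚ)) * h3

theorem coeff_rescale_exp_neg (n : ℕ) :
    PowerSeries.coeff n (PowerSeries.rescale (-1 / 2 : ℚ) (PowerSeries.exp ℚ)) =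
      (-1) ^ n * PowerSeries.coeff n (PowerSeries.rescale (1 / 2 : ℚ) (PowerSeries.exp ℚ)) := by
  rw [PowerSeries.coeff_rescale, PowerSeries.coeff_rescale, ← mul_assoc, ← mul_pow]
  norm_num

/-- Adding `t / 2` cancels `B_1`, the only nonzero Bernoulli number with odd index. -/
theorem coeff_bernoulliPowerSeries_add_odd (n : ℕ) :
    PowerSeries.coeff (2 * n + 1)
      (bernoulliPowerSeries ℚ + PowerSeries.C (1 / 2) * PowerSeries.X) = 0 := by
  rw [map_add, PowerSeries.coeff_C_mul, PowerSeries.coeff_X, bernoulliPowerSeries,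
    PowerSeries.coeff_mk]
  rcases Nat.eq_zero_or_pos n with rfl | hn
  · norm_num [bernoulli_one]
  · rw [bernoulli_eq_zero_of_odd ⟨n, rfl⟩ (by omega), if_neg (by omega)]
    simp

/-- The identity `x * coth x * (sinh x / x) = cosh x`. -/
theorem cothSeries_mul_besselSeries_zero : cothSeries * besselSeries 0 = coshSeries := by
  ext n
  -- With `w = t ^ 2`, the coefficient at `w ^ n` is read off at `t ^ (2 * n + 1)`; the terms with
  -- an odd power of `t` in the first factor vanish.
  have h := congrArg (PowerSeries.coeff (2 * n + 1)) bernoulliPowerSeries_add_mul_exp_sub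
  rw [PowerSeries.coeff_mul, Finset.Nat.sum_antidiagonal_eq_sum_range_succ_mk,
    sum_range_two_mul_add_two, mul_assoc, PowerSeries.coeff_C_mul, PowerSeries.coeff_succ_X_mul,
    map_add, coeff_rescale_exp_neg, PowerSeries.coeff_rescale, PowerSeries.coeff_exp] at h
  rw [PowerSeries.coeff_mul, Finset.Nat.sum_antidiagonal_eq_sum_range_succ_mk]
  calc _ = ∑ i ∈ Finset.range (n + 1), _ := Finset.sum_congr rfl fun i hi => ?_
    _ = _ := h
    _ = _ := ?_
  · have hi' : i ≤ n := by simpa [Nat.lt_succ_iff] using hi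
    simp only [coeff_bernoulliPowerSeries_add_odd, zero_mul, add_zero]
    obtain ⟨j, rfl⟩ := Nat.exists_eq_add_of_le hi'
    rw [show 2 * (i + j) + 1 - 2 * i = 2 * j + 1 by omega, Nat.add_sub_cancel_left, map_sub,
      coeff_rescale_exp_neg, PowerSeries.coeff_rescale, PowerSeries.coeff_exp, map_add,
      PowerSeries.coeff_C_mul, PowerSeries.coeff_X, if_neg (by omega)]
    simp only [cothSeries, besselSeries, bernoulliPowerSeries, PowerSeries.coeff_mk,
      Nat.factorial_eq_mul_doubleFactorial (2 * j), mul_zero, zero_add, pow_succ, pow_mul]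
    have h1 : ((2 * j)‼ : ℚ) ≠ 0 := by exact_mod_cast (Nat.doubleFactorial_pos _).ne'
    have h2 : ((2 * j + 1)‼ : ℚ) ≠ 0 := by exact_mod_cast (Nat.doubleFactorial_pos _).ne'
    simp
    field_simp
    norm_num [← mul_pow]
  · have h4 : (1 / 2 : ℚ) ^ (2 * n) = 1 / 4 ^ n := by rw [pow_mul, ← one_div_pow]; norm_num
    rw [h4, pow_mul (-1 : ℚ), neg_one_sq, one_pow, coshSeries, PowerSeries.coeff_mk,
      Algebra.algebraMap_self_apply]
    ring

/-- The Bessel recurrence at its start, where `cosh x` plays the role of order `-1`. -/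
theorem coshSeries_eq :
    coshSeries = besselSeries 0 + PowerSeries.C (1 / 4) * PowerSeries.X * besselSeries 1 := by
  ext m
  rw [map_add, mul_assoc, PowerSeries.coeff_C_mul]
  cases m with
  | zero => simp [coshSeries, besselSeries]
  | succ m =>
    rw [PowerSeries.coeff_succ_X_mul]
    simp only [coshSeries, besselSeries, PowerSeries.coeff_mk]
    rw [show 2 * (m + 1) = 2 * m + 1 + 1 by ring, Nat.factorial_eq_mul_doubleFactorial,
      show 2 * 0 + (2 * m + 1 + 1) + 1 = 2 * m + 1 + 2 by ring,
      show 2 * 1 + 2 * m + 1 = 2 * m + 1 + 2 by ring,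
      Nat.doubleFactorial_add_two (2 * m + 1), show 2 * m + 1 + 1 = 2 * m + 2 by ring,
      Nat.doubleFactorial_add_two (2 * m)]
    have h1 := Nat.doubleFactorial_pos (2 * m)
    have h2 := Nat.doubleFactorial_pos (2 * m + 1)
    push_cast
    field_simp
    ring

/-- The three-term recurrence of the modified spherical Bessel functions. -/
theorem besselSeries_eq (n : ℕ) :
    besselSeries n = PowerSeries.C (2 * n + 3 : ℚ) * besselSeries (n + 1) +
      PowerSeries.C (1 / 4) * PowerSeries.X * besselSeries (n + 2) := by
  ext m
  rw [map_add, mul_assoc, PowerSeries.coeff_C_mul, PowerSeries.coeff_C_mul]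
  cases m with
  | zero =>
    simp only [besselSeries, PowerSeries.coeff_mk, PowerSeries.coeff_zero_X_mul]
    rw [show 2 * (n + 1) + 2 * 0 + 1 = 2 * n + 1 + 2 by ring, Nat.doubleFactorial_add_two]
    have h2 := Nat.doubleFactorial_pos (2 * n + 1)
    push_cast
    simp only [mul_zero, add_zero]
    field_simp
    ring
  | succ m =>
    rw [PowerSeries.coeff_succ_X_mul]
    simp only [besselSeries, PowerSeries.coeff_mk]
    rw [show 2 * (n + 1) + 2 * (m + 1) + 1 = 2 * n + 2 * m + 3 + 2 by ring,
      show 2 * (n + 2) + 2 * m + 1 = 2 * n + 2 * m + 3 + 2 by ring,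
      show 2 * n + 2 * (m + 1) + 1 = 2 * n + 2 * m + 3 by ring,
      show 2 * (m + 1) = 2 * m + 2 by ring,
      Nat.doubleFactorial_add_two (2 * m), Nat.doubleFactorial_add_two (2 * n + 2 * m + 3)]
    have h1 := Nat.doubleFactorial_pos (2 * m)
    have h2 := Nat.doubleFactorial_pos (2 * n + 2 * m + 3)
    push_cast
    field_simp
    ring

/-! ### The continued fraction of `x * coth x` -/

open Polynomial in
/-- The sequence starting with `a`, `b` that follows the three-term recurrence of the functions
`(w / 4) ^ n * besselSeries n`. -/
noncomputable def besselRec (a b : ℚ[X]) : ℕ → ℚ[X]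
  | 0 => a
  | 1 => b
  | n + 2 => C (1 / 4) * X * besselRec a b n - C (2 * n + 3 : ℚ) * besselRec a b (n + 1)

/-- Both sides satisfy the same recurrence in `n` and agree for `n = 0` and `n = 1`. -/
theorem besselRec_mul_add (n : ℕ) :
    (besselRec 0 1 n : PowerSeries ℚ) * coshSeries +
        (besselRec 1 (-1) n : PowerSeries ℚ) * besselSeries 0 =
      (PowerSeries.C (1 / 4) * PowerSeries.X) ^ n * besselSeries n := by
  induction n using Nat.twoStepInduction with
  | zero => simp [besselRec]
  | one =>
    simp only [besselRec, coshSeries_eq]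
    simp
  | more n ih0 ih1 =>
    have h := besselSeries_eq n
    simp only [besselRec, Polynomial.coe_sub, Polynomial.coe_mul, Polynomial.coe_C,
      Polynomial.coe_X]
    linear_combination (PowerSeries.C (1 / 4) * PowerSeries.X) * ih0 -
      PowerSeries.C (2 * n + 3 : ℚ) * ih1 +
      (PowerSeries.C (1 / 4) * PowerSeries.X) ^ (n + 1) * h

/-- The degree bound `n / 2`. -/
theorem coeff_besselRec_of_lt (a b : ℚ) (n j : ℕ) (hj : n < 2 * j) :
    (besselRec (Polynomial.C a) (Polynomial.C b) n).coeff j = 0 := by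
  induction n using Nat.twoStepInduction generalizing j with
  | zero => exact Polynomial.coeff_C_of_ne_zero (by omega)
  | one => exact Polynomial.coeff_C_of_ne_zero (by omega)
  | more n ih0 ih1 =>
    obtain ⟨j, rfl⟩ : ∃ i, j = i + 1 := ⟨j - 1, by omega⟩
    rw [besselRec, Polynomial.coeff_sub, mul_assoc, Polynomial.coeff_C_mul, Polynomial.coeff_X_mul,
      Polynomial.coeff_C_mul, ih0 j (by omega), ih1 (j + 1) (by omega)]
    simp

/-- The degree bound `(n - 1) / 2`, better than the general one by starting from `0`. -/
theorem coeff_besselRec_zero_one_of_le (n j : ℕ) (hj : n ≤ 2 * j) :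
    (besselRec 0 1 n).coeff j = 0 := by
  induction n using Nat.twoStepInduction generalizing j with
  | zero => simp [besselRec]
  | one => exact Polynomial.coeff_one (R := ℚ) |>.trans (if_neg (by omega))
  | more n ih0 ih1 =>
    obtain ⟨j, rfl⟩ : ∃ i, j = i + 1 := ⟨j - 1, by omega⟩
    rw [besselRec, Polynomial.coeff_sub, mul_assoc, Polynomial.coeff_C_mul, Polynomial.coeff_X_mul,
      Polynomial.coeff_C_mul, ih0 j (by omega), ih1 (j + 1) (by omega)]
    simp

theorem coeff_zero_besselRec_zero_one (n : ℕ) :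
    (besselRec 0 1 (n + 1)).coeff 0 = (-1) ^ n * ((2 * n + 1)‼ : ℚ) := by
  induction n with
  | zero => simp [besselRec]
  | succ n ih =>
    rw [besselRec, Polynomial.coeff_sub, mul_assoc, Polynomial.coeff_C_mul,
      Polynomial.coeff_X_mul_zero, Polynomial.coeff_C_mul, ih,
      show 2 * (n + 1) + 1 = 2 * n + 1 + 2 by ring, Nat.doubleFactorial_add_two]
    push_cast
    ring

/-- Divisibility by `X ^ n`: the polynomials form a Padé approximant of `x * coth x`. -/
theorem besselRec_mul_cothSeries_add (n : ℕ) :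
    (besselRec 0 1 n : PowerSeries ℚ) * cothSeries + (besselRec 1 (-1) n : PowerSeries ℚ) =
      PowerSeries.X ^ n * (PowerSeries.C ((1 / 4) ^ n) * besselSeries n * (besselSeries 0)⁻¹) := by
  have h0 : besselSeries 0 * (besselSeries 0)⁻¹ = 1 :=
    PowerSeries.mul_inv_cancel _ (by simp [besselSeries])
  have h := besselRec_mul_add n
  rw [← cothSeries_mul_besselSeries_zero, mul_pow, ← map_pow] at h
  linear_combination (besselSeries 0)⁻¹ * h -
    ((besselRec 0 1 n : PowerSeries ℚ) * cothSeries + (besselRec 1 (-1) n : PowerSeries ℚ)) * h0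

/-- For `j > n / 2` the polynomial `besselRec 1 (-1) n` does not contribute to the coefficient at
`X ^ j`. -/
theorem coeff_besselRec_mul_cothSeries (n j : ℕ) (hnj : n < 2 * j) (hj : j ≤ n) :
    PowerSeries.coeff j ((besselRec 0 1 n : PowerSeries ℚ) * cothSeries) =
      if j = n then 1 / (4 ^ n * ((2 * n + 1)‼ : ℚ)) else 0 := by
  have h := congrArg (PowerSeries.coeff j) (besselRec_mul_cothSeries_add n)
  have hq := coeff_besselRec_of_lt 1 (-1) n j hnj
  rw [map_neg, map_one] at hq
  rw [map_add, Polynomial.coeff_coe, hq, add_zero] at h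
  rw [h, PowerSeries.coeff_X_pow_mul']
  split_ifs with h1 h2 h2
  · subst h2
    simp [besselSeries, mul_comm]
  · omega
  · omega
  · rfl

/-- Reading the coefficients of `besselRec 0 1 n` backwards gives a combination of the rows of the
Hankel matrix of `B_{2m} / (2m)!` that is supported at the last entry. -/
theorem sum_besselRec_mul_bernoulli (s N j : ℕ) (hs : s = 1 ∨ s = 2) (hj : j ≤ N) :
    ∑ i ∈ Finset.range (N + 1), (besselRec 0 1 (2 * N + s)).coeff (N - i) *
        (bernoulli (2 * (i + j + s)) / ((2 * (i + j + s))! : ℚ)) =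
      if j = N then 1 / (4 ^ (2 * N + s) * ((2 * (2 * N + s) + 1)‼ : ℚ)) else 0 := by
  have h := coeff_besselRec_mul_cothSeries (2 * N + s) (N + j + s) (by omega) (by omega)
  rw [PowerSeries.coeff_mul, Finset.Nat.sum_antidiagonal_eq_sum_range_succ_mk] at h
  have hsub : Finset.range (N + 1) ⊆ Finset.range (N + j + s).succ := by
    intro i; simp; omega
  rw [← Finset.sum_subset hsub, ← Finset.sum_range_reflect] at h
  · rw [if_congr (show N + j + s = 2 * N + s ↔ j = N by omega) rfl rfl] at h
    rw [← h]
    refine Finset.sum_congr rfl fun i hi => ?_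
    have hi' : i ≤ N := by simpa [Nat.lt_succ_iff] using hi
    simp only [Polynomial.coeff_coe, cothSeries, PowerSeries.coeff_mk]
    rw [show N + 1 - 1 - i = N - i by omega, show N + j + s - (N - i) = i + j + s by omega]
  · intro i _ hi
    simp only [Polynomial.coeff_coe]
    rw [coeff_besselRec_zero_one_of_le _ _ (by simp at hi; omega), zero_mul]

/-! ### Hankel determinants of Bernoulli numbers -/

/-- The Hankel matrix of the numbers `B_{2m} / (2m)!` with `m ≥ s`. -/
def bernoulliHankelShift (s N : ℕ) : Matrix (Fin N) (Fin N) ℚ :=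
  hankelMatrix (fun m => bernoulli (2 * (m + s)) / ((2 * (m + s))! : ℚ)) N

theorem det_bernoulliHankelShift_succ (s N : ℕ) (hs : s = 1 ∨ s = 2) :
    (bernoulliHankelShift s (N + 1)).det =
      (-1) ^ (s + 1) / (4 ^ (2 * N + s) * ((4 * N + 2 * s - 1)‼ : ℚ) * ((4 * N + 2 * s + 1)‼ : ℚ)) *
        (bernoulliHankelShift s N).det := by
  have h := det_hankelMatrix_succ
    (fun m => bernoulli (2 * (m + s)) / ((2 * (m + s))! : ℚ))
    (fun i => (besselRec 0 1 (2 * N + s)).coeff (N - i)) N _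
    (fun j hj => (sum_besselRec_mul_bernoulli s N j hs hj.le).trans (if_neg hj.ne))
    (sum_besselRec_mul_bernoulli s N N hs le_rfl)
  obtain ⟨t, rfl⟩ : ∃ t, s = t + 1 := ⟨s - 1, by omega⟩
  rw [if_pos rfl, Nat.sub_self, ← add_assoc, coeff_zero_besselRec_zero_one] at h
  have hsign : ((-1 : ℚ)) ^ (2 * N + t) = (-1) ^ t := by rw [pow_add, pow_mul]; simp
  have hsq : ((-1 : ℚ)) ^ t * (-1) ^ t = 1 := by rw [← mul_pow]; simp
  rw [hsign, show 2 * (2 * N + t) + 1 = 4 * N + 2 * t + 1 by ring,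
    show 2 * (2 * N + t + 1) + 1 = 4 * N + 2 * t + 3 by ring] at h
  rw [show 4 * N + 2 * (t + 1) - 1 = 4 * N + 2 * t + 1 by omega,
    show 4 * N + 2 * (t + 1) + 1 = 4 * N + 2 * t + 3 by ring]
  change _ * (bernoulliHankelShift (t + 1) (N + 1)).det =
    _ * (bernoulliHankelShift (t + 1) N).det at h
  have h1 : ((4 * N + 2 * t + 1)‼ : ℚ) ≠ 0 := by exact_mod_cast (Nat.doubleFactorial_pos _).ne'
  have h2 : ((4 * N + 2 * t + 3)‼ : ℚ) ≠ 0 := by exact_mod_cast (Nat.doubleFactorial_pos _).ne'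
  rw [show (-1 : ℚ) ^ (t + 1 + 1) = (-1) ^ t by ring, ← add_assoc]
  field_simp
  field_simp at h
  linear_combination (-1) ^ t * h - (bernoulliHankelShift (t + 1) (N + 1)).det *
    (4 ^ (2 * N + t + 1) * ((4 * N + 2 * t + 1)‼ : ℚ) * ((4 * N + 2 * t + 3)‼ : ℚ)) * hsq

theorem det_bernoulliHankel (m : ℕ) :
    (bernoulliHankel m).det = (-1) ^ m * ∏ n ∈ Finset.Icc 1 m,
      ((2 * n)! : ℚ) ^ 2 / (((4 * n)! : ℚ) * ((4 * n + 1)! : ℚ)) := by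
  have heq : bernoulliHankel m = bernoulliHankelShift 2 m := by
    ext i j
    simp only [bernoulliHankel, bernoulliHankelShift, hankelMatrix, Matrix.of_apply]
    rw [show (i : ℕ) + 1 + (j + 1) = i + j + 2 by ring]
  rw [heq]
  clear heq
  induction m with
  | zero => simp
  | succ m ih =>
    rw [det_bernoulliHankelShift_succ 2 m (Or.inr rfl), ih,
      Finset.prod_Icc_succ_top (by omega : 1 ≤ m + 1),
      show 4 * m + 2 * 2 - 1 = 4 * m + 3 by omega, show 4 * m + 2 * 2 + 1 = 4 * m + 5 by ring,
      show 4 * (m + 1) + 1 = 4 * m + 4 + 1 by ring,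
      Nat.factorial_eq_mul_doubleFactorial (4 * m + 4),
      show 4 * (m + 1) = 4 * m + 3 + 1 by ring, Nat.factorial_eq_mul_doubleFactorial (4 * m + 3),
      show 4 * m + 3 + 1 = 2 * (2 * m + 2) by ring, show 2 * (2 * m + 2) + 1 = 4 * m + 5 by ring,
      Nat.doubleFactorial_two_mul, show 2 * (m + 1) = 2 * m + 2 by ring]
    have h1 : ((4 * m + 3)‼ : ℚ) ≠ 0 := by exact_mod_cast (Nat.doubleFactorial_pos _).ne'
    have h2 : ((4 * m + 5)‼ : ℚ) ≠ 0 := by exact_mod_cast (Nat.doubleFactorial_pos _).ne'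
    have h3 : ((2 * m + 2)! : ℚ) ≠ 0 := by exact_mod_cast (Nat.factorial_pos _).ne'
    have h4 : (4 : ℚ) ^ (2 * m + 2) = 2 ^ (2 * m + 2) * 2 ^ (2 * m + 2) := by
      rw [← mul_pow]; norm_num
    push_cast
    rw [h4]
    field_simp
    ring

/-! ### The Betti minor as a Hankel determinant -/

/-- Reversing the order of rows and columns turns the even minor of the Betti matrix into a Hankel
matrix with scaled rows and columns. -/
theorem det_bettiEvenMinor (k : ℕ) :
    (bettiEvenMinor k).det =
      (∏ i ∈ Finset.range (k / 2), -((-1) ^ (k % 2) / 2 ^ (2 * k + 2) *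
          ((2 * k + 1 - 2 * (k / 2) + 2 * i)! : ℚ) ^ 2)) *
        (bernoulliHankelShift (1 + k % 2) (k / 2)).det := by
  set u : ℕ → ℚ := fun i => (-1) ^ i * ((2 * k + 1 - 2 * (k / 2) + 2 * i)! : ℚ) with hu
  have hrev : (bettiEvenMinor k).submatrix Fin.revPerm Fin.revPerm =
      Matrix.of fun i j : Fin (k / 2) => (-((-1) ^ (k % 2) / 2 ^ (2 * k + 2)) * u i) *
        Matrix.of (fun i j : Fin (k / 2) => u j * bernoulliHankelShift (1 + k % 2) (k / 2) i j)
          i j := by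
    ext i j
    have hi := i.2
    have hj := j.2
    simp only [bettiEvenMinor, bettiMatrix, bettiEntry, evenIndex, Matrix.submatrix_apply,
      Matrix.of_apply, Fin.revPerm_apply, Fin.val_rev, bernoulliHankelShift, hankelMatrix, hu]
    rw [show 2 * k + 1 - (2 * (k / 2 - (↑i + 1)) + 1 + 1) =
        2 * k + 1 - 2 * (k / 2) + 2 * i by omega,
      show 2 * k + 1 - (2 * (k / 2 - (↑j + 1)) + 1 + 1) =
        2 * k + 1 - 2 * (k / 2) + 2 * j by omega,
      show 2 * k + 2 - (2 * (k / 2 - (↑i + 1)) + 1 + 1) - (2 * (k / 2 - (↑j + 1)) + 1 + 1) =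
        2 * (i + j + (1 + k % 2)) by omega,
      show (2 * k + 1 - 2 * (k / 2) + 2 * i - (2 * (k / 2 - (↑j + 1)) + 1 + 1)) / 2 =
        i + j + k % 2 by omega,
      show 2 * (k / 2 - (↑i + 1)) + 1 + 1 + 1 = 2 * (k / 2 - (↑i + 1) + 1) + 1 by ring,
      pow_succ (-1 : ℚ) (2 * _), pow_mul (-1 : ℚ)]
    have hsign : (((-1 : ℚ)) ^ (i + j + k % 2 : ℕ))⁻¹ =
        (-1) ^ (k % 2) * (-1) ^ (i : ℕ) * (-1) ^ (j : ℕ) := by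
      rw [← inv_pow, pow_add, pow_add]
      norm_num
      ring
    rw [div_eq_mul_inv (bernoulli _) ((-1) ^ _), hsign]
    norm_num
    ring
  rw [← Matrix.det_submatrix_equiv_self Fin.revPerm, hrev, Matrix.det_mul_column,
    Matrix.det_mul_row, ← mul_assoc, ← Finset.prod_mul_distrib,
    ← Fin.prod_univ_eq_prod_range (fun i => -((-1) ^ (k % 2) / 2 ^ (2 * k + 2) *
          ((2 * k + 1 - 2 * (k / 2) + 2 * i)! : ℚ) ^ 2))]
  congr 1
  refine Finset.prod_congr rfl fun i _ => ?_
  have hsq : ((-1 : ℚ)) ^ (i : ℕ) * (-1) ^ (i : ℕ) = 1 := by rw [← mul_pow]; simp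
  simp only [hu]
  linear_combination -((-1) ^ (k % 2) / 2 ^ (2 * k + 2) *
          ((2 * k + 1 - 2 * (k / 2) + 2 * i)! : ℚ) ^ 2) * hsq

/-! ### Closed forms for the Betti minor -/

/-- Passing from `k` to `k + 1` raises every exponent `k - j` by one, which contributes the factor
`2 * 4 * ⋯ * (2 * k)`. -/
theorem prod_Icc_two_mul_pow_div_succ (k : ℕ) :
    ∏ j ∈ Finset.Icc 1 (k + 1), (2 * (j : ℚ)) ^ (k + 1 - j) / (2 * (j : ℚ) + 1) ^ (j + 1) =
      (∏ j ∈ Finset.Icc 1 k, (2 * (j : ℚ)) ^ (k - j) / (2 * (j : ℚ) + 1) ^ (j + 1)) *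
        (((2 * k)‼ : ℚ) / (2 * k + 3) ^ (k + 2)) := by
  have hd : ((2 * k)‼ : ℚ) = ∏ j ∈ Finset.Icc 1 k, (2 * (j : ℚ)) := by
    induction k with
    | zero => simp
    | succ k ih =>
      rw [Finset.prod_Icc_succ_top (by omega : 1 ≤ k + 1), ← ih,
        show 2 * (k + 1) = 2 * k + 2 by ring, Nat.doubleFactorial_add_two]
      push_cast
      ring
  have hlast : (2 * ((k + 1 : ℕ) : ℚ)) ^ (k + 1 - (k + 1)) /
      (2 * ((k + 1 : ℕ) : ℚ) + 1) ^ (k + 1 + 1) = 1 / (2 * k + 3) ^ (k + 2) := by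
    rw [Nat.sub_self, pow_zero]
    push_cast
    ring
  have hinit : ∏ j ∈ Finset.Icc 1 k, (2 * (j : ℚ)) ^ (k + 1 - j) / (2 * (j : ℚ) + 1) ^ (j + 1) =
      (∏ j ∈ Finset.Icc 1 k, (2 * (j : ℚ)) ^ (k - j) / (2 * (j : ℚ) + 1) ^ (j + 1)) *
        ∏ j ∈ Finset.Icc 1 k, (2 * (j : ℚ)) := by
    rw [← Finset.prod_mul_distrib]
    refine Finset.prod_congr rfl fun j hj => ?_
    rw [Finset.mem_Icc] at hj
    rw [show k + 1 - j = k - j + 1 by omega, pow_succ]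
    ring
  rw [Finset.prod_Icc_succ_top (by omega : 1 ≤ k + 1), hlast, hinit, hd]
  ring

/-- The factorials of `2N + c, 2N + c + 2, …, 4N + c - 2` and those of the same range for `N + 1`
differ only at the ends of the range. -/
theorem prod_factorial_succ (c N : ℕ) :
    (∏ i ∈ Finset.range (N + 1), ((2 * (N + 1) + c + 2 * i)! : ℚ)) * ((2 * N + c)! : ℚ) =
      (∏ i ∈ Finset.range N, ((2 * N + c + 2 * i)! : ℚ)) *
        (((4 * N + c)! : ℚ) * ((4 * N + c + 2)! : ℚ)) := by
  have h := Finset.prod_range_succ' (fun i => ((2 * N + c + 2 * i)! : ℚ)) (N + 1)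
  rw [Finset.prod_range_succ, Finset.prod_range_succ] at h
  rw [show 4 * N + c = 2 * N + c + 2 * N by ring,
    show 2 * N + c + 2 * N + 2 = 2 * N + c + 2 * (N + 1) by ring, ← mul_assoc, h]
  congr 1
  exact Finset.prod_congr rfl fun i _ => by
    rw [show 2 * (N + 1) + c + 2 * i = 2 * N + c + 2 * (i + 1) by ring]

/-- For `N = 0` the truncated `2 * N - 1` gives `0‼ = 1`, as it should. -/
theorem factorial_two_mul_eq_doubleFactorial_mul (N : ℕ) :
    (2 * N)! = (2 * N)‼ * (2 * N - 1)‼ := by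
  cases N with
  | zero => rfl
  | succ N => exact Nat.factorial_eq_mul_doubleFactorial (2 * N + 1)

theorem prod_range_neg_mul_sq (N : ℕ) (a : ℚ) (f : ℕ → ℚ) :
    ∏ i ∈ Finset.range N, -(a * f i ^ 2) = (-a) ^ N * (∏ i ∈ Finset.range N, f i) ^ 2 := by
  rw [← Finset.prod_pow]
  calc _ = ∏ i ∈ Finset.range N, (-a) * f i ^ 2 := Finset.prod_congr rfl fun i _ => by ring
    _ = _ := by rw [Finset.prod_mul_distrib, Finset.prod_const, Finset.card_range]

theorem four_pow_eq (n : ℕ) : (4 : ℚ) ^ n = 2 ^ (2 * n) := by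
  rw [pow_mul]
  norm_num

/-- The value of the even Betti minor for `k = 2 * N`. -/
theorem prod_even_mul_det_bernoulliHankelShift_one (N : ℕ) :
    (∏ i ∈ Finset.range N, -(1 / 2 ^ (4 * N + 2) * ((2 * N + 1 + 2 * i)! : ℚ) ^ 2)) *
        (bernoulliHankelShift 1 N).det =
      ((4 * N + 1)‼ : ℚ) / ((-2) ^ N * ((2 * N - 1)‼ : ℚ)) *
          (((4 * N + 1)‼ : ℚ) / 2 ^ (2 * N + 1)) ^ (2 * N) *
          ∏ j ∈ Finset.Icc 1 (2 * N),
            (2 * (j : ℚ)) ^ (2 * N - j) / (2 * (j : ℚ) + 1) ^ (j + 1) := by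
  rw [prod_range_neg_mul_sq]
  induction N with
  | zero => simp [bernoulliHankelShift]
  | succ N ih =>
    have hP := prod_factorial_succ 1 N
    rw [← eq_div_iff (by positivity)] at hP
    rw [det_bernoulliHankelShift_succ 1 N (Or.inl rfl), hP,
      show 2 * (N + 1) = 2 * N + 1 + 1 by ring,
      prod_Icc_two_mul_pow_div_succ, prod_Icc_two_mul_pow_div_succ]
    -- Up to the values at `N`, everything is expressed in the double factorials of `2 * N`,
    -- `2 * N - 1` and one of order `4 * N`, in powers of two, and in linear factors in `N`.
    generalize (∏ i ∈ Finset.range N, ((2 * N + 1 + 2 * i)! : ℚ)) = F at ih ⊢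
    generalize (bernoulliHankelShift 1 N).det = D at ih ⊢
    generalize (∏ j ∈ Finset.Icc 1 (2 * N),
      (2 * (j : ℚ)) ^ (2 * N - j) / (2 * (j : ℚ) + 1) ^ (j + 1))
      = W at ih ⊢
    rw [show 4 * (N + 1) + 1 = 4 * N + 3 + 2 by ring, show 4 * N + 1 + 2 = 4 * N + 2 + 1 by ring,
      show 4 * N + 2 * 1 - 1 = 4 * N + 1 by omega, show 4 * N + 2 * 1 + 1 = 4 * N + 1 + 2 by ring,
      show 2 * (2 * N + 1) = 2 * (2 * N) + 2 by ring, show 2 * N + 1 + 1 - 1 = 2 * N + 1 by omega,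
      Nat.doubleFactorial_add_two (4 * N + 3), Nat.doubleFactorial_add_two (4 * N + 1),
      Nat.doubleFactorial_add_two (2 * (2 * N)),
      Nat.factorial_eq_mul_doubleFactorial (4 * N),
      Nat.factorial_eq_mul_doubleFactorial (4 * N + 2),
      show 4 * N + 2 + 1 = 4 * N + 1 + 2 by ring, Nat.doubleFactorial_add_two (4 * N + 1),
      Nat.doubleFactorial_add_two (4 * N), Nat.factorial_eq_mul_doubleFactorial (2 * N),
      show 4 * N = 2 * (2 * N) by ring, Nat.doubleFactorial_two_mul (2 * N),
      factorial_two_mul_eq_doubleFactorial_mul, Nat.doubleFactorial_add_one (2 * N)]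
    rw [show 4 * N = 2 * (2 * N) by ring] at ih
    have hA : ((2 * (2 * N) + 1)‼ : ℚ) ≠ 0 := by exact_mod_cast (Nat.doubleFactorial_pos _).ne'
    have he : ((2 * N)‼ : ℚ) ≠ 0 := by exact_mod_cast (Nat.doubleFactorial_pos _).ne'
    have ho : ((2 * N - 1)‼ : ℚ) ≠ 0 := by exact_mod_cast (Nat.doubleFactorial_pos _).ne'
    push_cast
    generalize ((2 * (2 * N) + 1)‼ : ℚ) = A at *
    generalize ((2 * N)‼ : ℚ) = e at *
    generalize ((2 * N - 1)‼ : ℚ) = o at *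
    have hc : (-(1 / 2 ^ (2 * (2 * N) + 2)) : ℚ) ^ N ≠ 0 := pow_ne_zero _ (by simp)
    have hFD : F ^ 2 * D = (A / ((-2) ^ N * o) * (A / 2 ^ (2 * N + 1)) ^ (2 * N) * W) /
        (-(1 / 2 ^ (2 * (2 * N) + 2))) ^ N := by
      rw [eq_div_iff hc, ← ih]
      ring
    have hx : (4 * N + 3 : ℚ) ≠ 0 := by positivity
    have hy : (4 * N + 5 : ℚ) ≠ 0 := by positivity
    have hz : (2 * N + 1 : ℚ) ≠ 0 := by positivity
    have hGD (c K G : ℚ) : c * (F * G) ^ 2 * (K * D) = c * G ^ 2 * K * (F ^ 2 * D) := by ring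
    rw [mul_div_assoc F, hGD, hFD, four_pow_eq,
      show (2 * (2 * N) + 1 + 2 : ℚ) = 4 * N + 3 by ring,
      show (2 * (2 * N) + 3 : ℚ) = 4 * N + 3 by ring,
      show (4 * N + 3 + 2 : ℚ) = 4 * N + 5 by ring,
      show (2 * (2 * N + 1) + 3 : ℚ) = 4 * N + 5 by ring,
      show (2 * (2 * N) + 2 : ℚ) = 2 * (2 * N + 1) by ring]
    generalize (4 * N + 3 : ℚ) = x at *
    generalize (4 * N + 5 : ℚ) = y at *
    generalize (2 * N + 1 : ℚ) = z at *
    have hn (m n : ℕ) : (-(1 / 2 ^ m) : ℚ) ^ n = (-1) ^ n / 2 ^ (m * n) := by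
      rw [neg_pow, div_pow, one_pow, mul_one_div, pow_mul]
    simp only [hn, neg_pow (2 : ℚ), ← pow_mul, div_pow, mul_pow]
    field_simp
    ring

/-- The value of the even Betti minor for `k = 2 * N + 1`. -/
theorem prod_odd_mul_det_bernoulliHankelShift_two (N : ℕ) :
    (∏ i ∈ Finset.range N, -(-1 / 2 ^ (4 * N + 4) * ((2 * N + 3 + 2 * i)! : ℚ) ^ 2)) *
        (bernoulliHankelShift 2 N).det =
      ((4 * N + 3)‼ : ℚ) ^ 2 / ((-2) ^ N * ((2 * N)‼ : ℚ) * ((2 * N + 1)‼ : ℚ) ^ 2) *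
          (((4 * N + 3)‼ : ℚ) / 2 ^ (2 * N + 2)) ^ (2 * N) *
          ∏ j ∈ Finset.Icc 1 (2 * N + 1),
            (2 * (j : ℚ)) ^ (2 * N + 1 - j) / (2 * (j : ℚ) + 1) ^ (j + 1) := by
  rw [prod_range_neg_mul_sq]
  induction N with
  | zero =>
    norm_num [bernoulliHankelShift, Nat.doubleFactorial]
  | succ N ih =>
    have hP := prod_factorial_succ 3 N
    rw [← eq_div_iff (by positivity)] at hP
    rw [det_bernoulliHankelShift_succ 2 N (Or.inr rfl), hP,
      show 2 * (N + 1) + 1 = 2 * N + 1 + 1 + 1 by ring,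
      prod_Icc_two_mul_pow_div_succ, prod_Icc_two_mul_pow_div_succ]
    -- Up to the values at `N`, everything is expressed in the double factorials of `2 * N`,
    -- `2 * N - 1` and one of order `4 * N`, in powers of two, and in linear factors in `N`.
    generalize (∏ i ∈ Finset.range N, ((2 * N + 3 + 2 * i)! : ℚ)) = F at ih ⊢
    generalize (bernoulliHankelShift 2 N).det = D at ih ⊢
    generalize (∏ j ∈ Finset.Icc 1 (2 * N + 1),
      (2 * (j : ℚ)) ^ (2 * N + 1 - j) / (2 * (j : ℚ) + 1) ^ (j + 1)) = W at ih ⊢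
    rw [show 4 * (N + 1) + 3 = 4 * N + 5 + 2 by ring, show 4 * N + 3 + 2 = 4 * N + 4 + 1 by ring,
      show 4 * N + 2 * 2 - 1 = 4 * N + 3 by omega, show 4 * N + 2 * 2 + 1 = 4 * N + 3 + 2 by ring,
      show 2 * (2 * N + 1 + 1) = 2 * (2 * N) + 2 + 2 by ring,
      show 2 * (2 * N + 1) = 2 * (2 * N) + 2 by ring,
      show 2 * (N + 1) = 2 * N + 2 by ring, show 2 * N + 1 + 1 + 1 = 2 * N + 1 + 2 by ring,
      show 2 * N + 3 = 2 * N + 2 + 1 by ring,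
      Nat.doubleFactorial_add_two (4 * N + 5), Nat.doubleFactorial_add_two (4 * N + 3),
      Nat.doubleFactorial_add_two (2 * (2 * N) + 2),
      Nat.doubleFactorial_add_two (2 * (2 * N)),
      Nat.factorial_eq_mul_doubleFactorial (4 * N + 2),
      Nat.factorial_eq_mul_doubleFactorial (4 * N + 4),
      Nat.factorial_eq_mul_doubleFactorial (2 * N + 2),
      show 4 * N + 4 + 1 = 4 * N + 3 + 2 by ring, show 4 * N + 2 + 1 = 4 * N + 3 by ring,
      Nat.doubleFactorial_add_two (4 * N + 3),
      show 2 * N + 2 + 1 = 2 * N + 1 + 2 by ring,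
      Nat.doubleFactorial_add_two (2 * N + 1), Nat.doubleFactorial_add_two (2 * N),
      Nat.doubleFactorial_add_two (4 * N + 2), Nat.doubleFactorial_add_two (4 * N),
      show 4 * N = 2 * (2 * N) by ring, Nat.doubleFactorial_two_mul (2 * N),
      factorial_two_mul_eq_doubleFactorial_mul, Nat.doubleFactorial_add_one (2 * N)]
    rw [show 4 * N = 2 * (2 * N) by ring, Nat.doubleFactorial_add_one (2 * N)] at ih
    have hA : ((2 * (2 * N) + 3)‼ : ℚ) ≠ 0 := by exact_mod_cast (Nat.doubleFactorial_pos _).ne'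
    have he : ((2 * N)‼ : ℚ) ≠ 0 := by exact_mod_cast (Nat.doubleFactorial_pos _).ne'
    have ho : ((2 * N - 1)‼ : ℚ) ≠ 0 := by exact_mod_cast (Nat.doubleFactorial_pos _).ne'
    push_cast at ih ⊢
    generalize ((2 * (2 * N) + 3)‼ : ℚ) = A at *
    generalize ((2 * N)‼ : ℚ) = e at *
    generalize ((2 * N - 1)‼ : ℚ) = o at *
    have hn (m n : ℕ) : (-(-1 / 2 ^ m) : ℚ) ^ n = 1 / 2 ^ (m * n) := by
      rw [neg_div, neg_neg, div_pow, one_pow, pow_mul]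
    rw [hn] at ih ⊢
    have hFD : F ^ 2 * D = (A ^ 2 / ((-2) ^ N * e * ((2 * N + 1) * o) ^ 2) *
        (A / 2 ^ (2 * N + 2)) ^ (2 * N) * W) / (1 / 2 ^ ((2 * (2 * N) + 4) * N)) := by
      rw [eq_div_iff (by positivity), ← ih]
      ring
    have hx : (4 * N + 5 : ℚ) ≠ 0 := by positivity
    have hy : (4 * N + 7 : ℚ) ≠ 0 := by positivity
    have hz : (2 * N + 1 : ℚ) ≠ 0 := by positivity
    have hw : (2 * N + 3 : ℚ) ≠ 0 := by positivity
    have hu : (N + 1 : ℚ) ≠ 0 := by positivity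
    have hGD (c K G : ℚ) : c * (F * G) ^ 2 * (K * D) = c * G ^ 2 * K * (F ^ 2 * D) := by ring
    rw [mul_div_assoc F, hGD, hFD, four_pow_eq]
    rw [show (2 * (2 * N) + 3 + 2 : ℚ) = 4 * N + 5 by ring,
      show (2 * (2 * N + 1) + 3 : ℚ) = 4 * N + 5 by ring,
      show (4 * N + 5 + 2 : ℚ) = 4 * N + 7 by ring,
      show (2 * (2 * N + 2) + 3 : ℚ) = 4 * N + 7 by ring,
      show (2 * (2 * N) + 2 : ℚ) = 2 * (2 * N + 1) by ring,
      show (2 * (2 * N + 1) + 2 : ℚ) = 4 * (N + 1) by ring,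
      show (2 * N + 1 + 2 : ℚ) = 2 * N + 3 by ring, show (2 * N + 2 : ℚ) = 2 * (N + 1) by ring]
    generalize (4 * N + 5 : ℚ) = x at *
    generalize (4 * N + 7 : ℚ) = y at *
    generalize (2 * N + 1 : ℚ) = z at *
    generalize (2 * N + 3 : ℚ) = w at *
    generalize (N + 1 : ℚ) = u at *
    simp only [neg_pow (2 : ℚ), ← pow_mul, div_pow, mul_pow]
    field_simp
    ring

theorem corollary4p4 :
    (∀ k : ℕ, 1 ≤ k →
      (bettiEvenMinor k).det =
        ((2 * k + 1)‼ : ℚ) ^ ((3 - (-1) ^ k) / 2 : ℤ) /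
            ((-2) ^ (k / 2) * ((k - 1)‼ : ℚ) * (k‼ : ℚ) ^ (1 - (-1) ^ k : ℤ)) *
          (((2 * k + 1)‼ : ℚ) / 2 ^ (k + 1)) ^ (2 * (k / 2)) *
          ∏ j ∈ Finset.Icc 1 k, (2 * (j : ℚ)) ^ (k - j) / (2 * (j : ℚ) + 1) ^ (j + 1)) ∧
    (∀ m : ℕ, 1 ≤ m →
      (bernoulliHankel m).det =
        (-1) ^ m * ∏ n ∈ Finset.Icc 1 m,
          ((2 * n)! : ℚ) ^ 2 / (((4 * n)! : ℚ) * ((4 * n + 1)! : ℚ))) := by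
  refine ⟨fun k _ => ?_, fun m _ => det_bernoulliHankel m⟩
  rw [det_bettiEvenMinor]
  obtain ⟨N, rfl | rfl⟩ : ∃ N, k = 2 * N ∨ k = 2 * N + 1 := ⟨k / 2, by omega⟩
  · have h := prod_even_mul_det_bernoulliHankelShift_one N
    have he : ((3 - (-1) ^ (2 * N)) / 2 : ℤ) = 1 := by rw [pow_mul]; norm_num
    have he' : (1 - (-1) ^ (2 * N) : ℤ) = 0 := by rw [pow_mul]; norm_num
    rw [he, he', show 2 * N / 2 = N by omega, show 2 * N % 2 = 0 by omega,
      show 2 * (2 * N) + 1 - 2 * N = 2 * N + 1 by omega, ← mul_assoc 2 2 N, zpow_one, zpow_zero,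
      pow_zero, mul_one]
    exact h
  · have h := prod_odd_mul_det_bernoulliHankelShift_two N
    have he : ((3 - (-1) ^ (2 * N + 1)) / 2 : ℤ) = 2 := by rw [pow_succ, pow_mul]; norm_num
    have he' : (1 - (-1) ^ (2 * N + 1) : ℤ) = 2 := by rw [pow_succ, pow_mul]; norm_num
    rw [he, he', show (2 * N + 1) / 2 = N by omega, show (2 * N + 1) % 2 = 1 by omega,
      show 2 * (2 * N + 1) + 1 - 2 * N = 2 * N + 3 by omega,
      show 2 * (2 * N + 1) + 1 = 4 * N + 3 by ring, show 2 * (2 * N + 1) + 2 = 4 * N + 4 by ring,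
      Nat.add_sub_cancel, pow_one]
    exact_mod_cast h
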